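/- Fix $N\ge 2$ and $\varepsilon\in(0,1)$. Consider a discrete-time system of one server and $N$ parallel queues, with schedule set $\Pi=\{\mathbf 0\}\cup\{\mathbf e^{(i)}\}_{i=1}^N$ and maximum capacity region $\Lambda=\{\lambda\in\mathbb R_+^N:\lambda<y \text{ coordinatewise for some } y\in\mathrm{conv}(\Pi)\}=\{\lambda\ge 0:\sum_i\lambda_i<1\}$. A channel $\mathcal C=(\mathcal X,\mathcal Y,C)$ consists of finite sets $\mathcal X,\mathcal Y$ and a row-stochastic matrix $C=(C_{x,y})$; on input $x$ it outputs $y$ with probability $C_{x,y}$, independently of the past. It is *$\varepsilon$-majorizing* if $C=\varepsilon C^0+(1-\varepsilon)C^1$ with $C^0,C^1$ row stochastic, the rows of $C^0$ identical, and every column of $C^1$ containing a zero entry. An encoding policy with $k$ bits of memory is a map $\phi$, and a memoryless allocation policy is a map $\psi$ with values in $\Pi$ (both measurable in the randomization variable). In slot $t\ge 1$, $$(X(t),M(t))=\phi\big(Q(t-1),A(t-1),M(t-1),U_e(t-1)\big)\in\mathcal X\times\{0,1\}^k,$$ the channel produces $Y(t)$ from $X(t)$, and $$D(t)=\psi\big(Y(t),U_r(t-1)\big),\qquad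 Q(t)=(Q(t-1)-D(t))^++A(t),$$ where $U_e(\cdot),U_r(\cdot)$ are i.i.d. uniform on $(0,1)$, the $A_i(t)$ are independent Bernoulli variables with mean $\lambda_i\in[0,1]$, and all of these are independent of one another. The pair $(\phi,\psi)$ *stabilizes* $\lambda$ if the Markov chain $W(t)=(Q(t),A(t),M(t),X(t))$ is, up to transient states, irreducible and positive recurrent, that is, some state has a return time that is a.s. finite with finite mean and is visited a.s. from every initial state. Let $\tilde\Lambda(\phi,\psi)$ be the set of stabilized $\lambda$, let $\rho^*(\phi,\psi,\mathcal C)=\sup\{\rho\ge0:\rho\Lambda\subseteq\tilde\Lambda(\phi,\psi)\}$ (with $\sup\emptyset=0$), and let $\rho^*_{k,0}(\mathcal C)$ be the supremum of $\rho^*(\phi,\psi,\mathcal C)$ over all encoding policies $\phi$ with $k$ bits of memory and all memoryless allocation policies $\psi$ (again with $\sup\emptyset=0$). Then: 1. For every $\varepsilon$-majorizing channel $\mathcal C$ and every integer $k\ge0$, $$\rho^*_{k,0}(\mathcal C)\le 1-\varepsilon(1-N^{-1}),$$ and the limit $\rho^*_{\infty,0}(\mathcal C)=\lim_{k\to\infty}\rho^*_{k,0}(\mathcal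 C)$ exists and satisfies the same bound. 2. The channel $\mathcal C$ with $\mathcal X=\mathcal Y=\{1,\dots,N\}$ and $C=\varepsilon C^0+(1-\varepsilon)C^1$, where all entries of $C^0$ are $1/N$ and $C^1$ is the identity matrix, is $\varepsilon$-majorizing and satisfies $$\rho^*_{0,0}(\mathcal C)=1-\varepsilon(1-N^{-1}).$$ The value is attained by a memoryless pair: if the encoder sends the smallest index of a nonempty queue of $Q(t-1)$ (and a fixed arbitrary index if all queues are empty) and the receiver serves the queue whose index is the received message, then $\rho^*(\phi,\psi,\mathcal C)=1-\varepsilon(1-N^{-1})$. -/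

import Mathlib

open scoped ENNReal Topology
open MeasureTheory

noncomputable section

namespace SPII

/-! ### Channels -/

/-- A channel with finite input alphabet `X` and finite output alphabet `Y`: a row-stochastic
matrix, whose entry at `(x, y)` is the probability of the output `y` on the input `x`. -/
structure Channel (X Y : Type*) [Fintype X] [Fintype Y] where
  matrix : Matrix X Y ℝ
  nonneg : ∀ x y, 0 ≤ matrix x y
  row_sum : ∀ x, ∑ y, matrix x y = 1

/-- The law of the output message when the input signal is `x`. -/
def Channel.outputLaw {X Y : Type*} [Fintype X] [Fintype Y] (C : Channel X Y) (x : X) : PMF Y :=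
  PMF.ofFintype (fun y => ENNReal.ofReal (C.matrix x y)) (by
    rw [← ENNReal.ofReal_sum_of_nonneg (fun y _ => C.nonneg x y), C.row_sum x,
      ENNReal.ofReal_one])

/-- `C = ε C⁰ + (1 - ε) C¹` with `C⁰`, `C¹` row stochastic, the rows of `C⁰` identical, and
every column of `C¹` containing a zero. -/
def Channel.IsMajorizing {X Y : Type*} [Fintype X] [Fintype Y] (ε : ℝ) (C : Channel X Y) : Prop :=
  ∃ C0 C1 : Channel X Y,
    (∀ x x' y, C0.matrix x y = C0.matrix x' y) ∧
    (∀ y, ∃ x, C1.matrix x y = 0) ∧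
    C.matrix = ε • C0.matrix + (1 - ε) • C1.matrix

/-- The mixture `ε C⁰ + (1 - ε) C¹` of two channels. -/
def Channel.mix {X Y : Type*} [Fintype X] [Fintype Y] (ε : ℝ) (hε : ε ∈ Set.Ioo (0 : ℝ) 1)
    (C0 C1 : Channel X Y) : Channel X Y where
  matrix := ε • C0.matrix + (1 - ε) • C1.matrix
  nonneg x y := by
    have h0 := mul_nonneg hε.1.le (C0.nonneg x y)
    have h1 := mul_nonneg (sub_nonneg.2 hε.2.le) (C1.nonneg x y)
    simpa using add_nonneg h0 h1
  row_sum x := by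
    simp [Finset.sum_add_distrib, ← Finset.mul_sum, C0.row_sum, C1.row_sum]

/-- The noiseless channel on `N` symbols (channel matrix the identity). -/
def Channel.identity (N : ℕ) : Channel (Fin N) (Fin N) where
  matrix := 1
  nonneg x y := by rw [Matrix.one_apply]; split_ifs <;> norm_num
  row_sum x := by simp [Matrix.one_apply]

/-- The channel on `N` symbols all of whose entries are `1 / N`. -/
def Channel.uniform (N : ℕ) : Channel (Fin N) (Fin N) where
  matrix := fun _ _ => 1 / (N : ℝ)
  nonneg _ _ := by positivity
  row_sum x := by
    have hN : (N : ℝ) ≠ 0 := Nat.cast_ne_zero.2 (Fin.pos x).ne'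
    simp [hN]

/-! ### Policies -/

/-- The law on a finite set of `f U`, for `U` uniform on the unit interval. -/
def uniformLaw {Z : Type*} [Fintype Z] (f : unitInterval → Z)
    (hf : ∀ z, MeasurableSet {u | f u = z}) : PMF Z :=
  PMF.ofFintype (fun z => volume {u : unitInterval | f u = z}) (by
    have hd : Pairwise (Function.onFun Disjoint fun z => {u : unitInterval | f u = z}) := by
      intro z z' hz
      refine Set.disjoint_left.2 fun u hu hu' => hz ?_
      have h1 : f u = z := hu
      have h2 : f u = z' := hu'
      exact h1.symm.trans h2
    have hU : (⋃ z, {u : unitInterval | f u = z}) = Set.univ := by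
      ext u; simp
    have h := measure_iUnion (μ := (volume : Measure unitInterval)) hd hf
    rw [hU, measure_univ, tsum_fintype] at h
    exact h.symm)

/-- An encoding policy with `k` bits of memory for `N` queues and signals in `X`:
`(X(t), M(t)) = φ(Q(t-1), A(t-1), M(t-1), U(t-1))` with `U(t-1)` uniform on the unit interval. -/
structure EncodingPolicy (N : ℕ) (X : Type*) (k : ℕ) where
  toFun : (Fin N → ℕ) → (Fin N → Bool) → (Fin k → Bool) → unitInterval → X × (Fin k → Bool)
  measurable : ∀ q a m z, MeasurableSet {u | toFun q a m u = z}

/-- A memoryless allocation policy with schedules in `Sch`: `D(t) = ψ(Y(t), U(t-1))` with `U(t-1)`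
uniform on the unit interval. -/
structure AllocationPolicy {N : ℕ} (Y : Type*) (Sch : Finset (Fin N → ℕ)) where
  toFun : Y → unitInterval → Sch
  measurable : ∀ y d, MeasurableSet {u | toFun y u = d}

/-! ### Dynamics -/

/-- The law of `N` independent Bernoulli variables of means `lam i`. -/
def arrivalLaw {N : ℕ} (lam : Fin N → ℝ) (h : ∀ i, 0 ≤ lam i ∧ lam i ≤ 1) : PMF (Fin N → Bool) :=
  PMF.ofFintype (fun a => ∏ i, ENNReal.ofReal (if a i then lam i else 1 - lam i)) (by
    have h1 : ∀ i, ∑ b : Bool, ENNReal.ofReal (if b then lam i else 1 - lam i) = 1 := by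
      intro i
      rw [Fintype.sum_bool]
      simp only [if_true, Bool.false_eq_true, if_false]
      rw [← ENNReal.ofReal_add (h i).1 (sub_nonneg.2 (h i).2)]
      simp
    have := Fintype.prod_sum
      (fun (i : Fin N) (b : Bool) => ENNReal.ofReal (if b then lam i else 1 - lam i))
    rw [← this]
    exact Finset.prod_eq_one fun i _ => h1 i)

/-- The system state `W(t)`: queue lengths, most recent arrivals, encoder memory and most recent
signal. (The receiver has no memory.) -/
structure State (N : ℕ) (X : Type*) (k : ℕ) where
  queue : Fin N → ℕ
  arrival : Fin N → Bool
  memory : Fin k → Bool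
  signal : X

/-- One time slot: the encoder produces the signal and updates its memory, the channel produces
the message, the receiver chooses the schedule `d`, the new arrivals `a` are drawn, and
`Q(t) = (Q(t-1) - d)⁺ + a` (the subtraction of natural numbers is the truncated one). -/
def step {N : ℕ} {X Y : Type*} [Fintype X] [Fintype Y] {k : ℕ} {Sch : Finset (Fin N → ℕ)}
    (C : Channel X Y) (φ : EncodingPolicy N X k) (ψ : AllocationPolicy Y Sch)
    (lam : Fin N → ℝ) (h : ∀ i, 0 ≤ lam i ∧ lam i ≤ 1) (w : State N X k) : PMF (State N X k) :=
  (uniformLaw (φ.toFun w.queue w.arrival w.memory) (φ.measurable _ _ _)).bind fun xm =>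
  (C.outputLaw xm.1).bind fun y =>
  (uniformLaw (ψ.toFun y) (ψ.measurable y)).bind fun d =>
  (arrivalLaw lam h).bind fun a =>
  PMF.pure
    { queue := fun i => (w.queue i - d.1 i) + (a i).toNat
      arrival := a
      memory := xm.2
      signal := xm.1 }

/-! ### Positive recurrence -/

open Classical in
/-- For a Markov chain with transition law `P`, `firstPassage P j n i` is the probability that the
chain started at `i` visits `j` at time `n + 1` and at none of the times `1, …, n`. -/
def firstPassage {S : Type*} (P : S → PMF S) (j : S) : ℕ → S → ℝ≥0∞
  | 0, i => P i j
  | n + 1, i => ∑' l, if l = j then 0 else P i l * firstPassage P j n l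

/-- The chain has a state `j` whose return time is almost surely finite and has finite mean, and
which is visited almost surely from every initial state. For an irreducible chain this is positive
recurrence; in general it says that, apart from transient states (such as the ones
with a nonempty queue that receives no arrivals), the chain consists of a single class, into which
it is absorbed almost surely and on which it is irreducible and positive recurrent. -/
def PositiveRecurrent {S : Type*} (P : S → PMF S) : Prop :=
  ∃ j, (∀ i, ∑' n, firstPassage P j n i = 1) ∧
    ∑' n : ℕ, ((n : ℝ≥0∞) + 1) * firstPassage P j n j < ∞

/-! ### Capacity -/

/-- The maximum capacity region: nonnegative vectors strictly dominated by a point of the convex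
hull of the schedule set. -/
def maxCapacityRegion {N : ℕ} (Sch : Finset (Fin N → ℕ)) : Set (Fin N → ℝ) :=
  {lam | (∀ i, 0 ≤ lam i) ∧
    ∃ y ∈ convexHull ℝ ((fun (d : Fin N → ℕ) (i : Fin N) => (d i : ℝ)) '' (Sch : Set (Fin N → ℕ))),
      ∀ i, lam i < y i}

/-- The capacity region of a policy pair: the arrival rate vectors under which the system is
stable. (Bernoulli arrivals of mean `lam i` exist only for `lam i` in `[0, 1]`.) -/
def capacityRegion {N : ℕ} {X Y : Type*} [Fintype X] [Fintype Y] {k : ℕ}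
    {Sch : Finset (Fin N → ℕ)} (C : Channel X Y) (φ : EncodingPolicy N X k)
    (ψ : AllocationPolicy Y Sch) : Set (Fin N → ℝ) :=
  {lam | ∃ h : ∀ i, 0 ≤ lam i ∧ lam i ≤ 1, PositiveRecurrent (step C φ ψ lam h)}

/-- The capacity factor of a policy pair: the supremum of the `ρ ≥ 0` with `ρ Λ` contained in the
capacity region of the pair (and `0` if there is none). -/
def policyCapacityFactor {N : ℕ} {X Y : Type*} [Fintype X] [Fintype Y] {k : ℕ}
    {Sch : Finset (Fin N → ℕ)} (C : Channel X Y) (φ : EncodingPolicy N X k)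
    (ψ : AllocationPolicy Y Sch) : ℝ :=
  sSup {ρ : ℝ | 0 ≤ ρ ∧ ∀ lam ∈ maxCapacityRegion Sch, ρ • lam ∈ capacityRegion C φ ψ}

/-- The `(k, 0)`-capacity factor of a channel: the supremum of the capacity factors of the pairs of
an encoding policy with `k` bits of memory and a memoryless allocation policy. -/
def capacityFactor {N : ℕ} {X Y : Type*} [Fintype X] [Fintype Y] (Sch : Finset (Fin N → ℕ))
    (C : Channel X Y) (k : ℕ) : ℝ :=
  sSup {r : ℝ | ∃ (φ : EncodingPolicy N X k) (ψ : AllocationPolicy Y Sch),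
    r = policyCapacityFactor C φ ψ}

/-! ### One server and `N` parallel queues -/

/-- The schedule set `{0, e₁, …, e_N}`. -/
def parallelSchedules (N : ℕ) : Finset (Fin N → ℕ) :=
  insert 0 (Finset.univ.image fun i : Fin N => Pi.single i 1)

/-- The memoryless encoder that sends the smallest index of a nonempty queue, and the index `i₀`
if all the queues are empty. -/
def firstNonemptyEncoder {N : ℕ} (i₀ : Fin N) : EncodingPolicy N (Fin N) 0 where
  toFun q _ m _ := ((Finset.univ.filter fun i => 0 < q i).min.untopD i₀, m)
  measurable _ _ _ _ := MeasurableSet.const _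

/-- The memoryless receiver that serves the queue whose index is the received message. -/
def serveMessage (N : ℕ) : AllocationPolicy (Fin N) (parallelSchedules N) where
  toFun y _ := ⟨Pi.single y 1, by simp [parallelSchedules]⟩
  measurable _ _ := MeasurableSet.const _

end SPII

end

noncomputable section

namespace SPII

/-! ### Expectations under discrete laws -/

/-! Upper bound: with probability `ε` the output is drawn from the common row of `C⁰` and carries no
information on the signal. A schedule serves at most one queue, so some queue `i` receives mean
service at most `1 / N` from this part; the other part gives it at most `1`. Hence whatever the
encoder sends, and whatever it remembers, the mean service of queue `i` is at most `b = ε / N + (1 -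
ε)`, which is the claimed value. If `ρ > b`, load only queue `i`, at a rate in `(b, ρ)`: its length
has uniformly positive drift and grows by at most one per slot, which
`not_positiveRecurrent_of_drift` excludes. This is `le_of_smul_subset_capacityRegion`.

Limit: an unused memory bit costs nothing, so the capacity factor is nondecreasing in `k`, and it is
bounded.

Attainment: on the uniform/identity mixture every symbol is received correctly with probability
exactly `b`. Sending the index of a nonempty queue therefore makes the total queue length drift down
by at least `b - ∑ λ i` off the empty configuration, and the Foster criterion
`PositiveRecurrent.of_foster` applies (`positiveRecurrent_firstNonempty`).

All estimates live in `ℝ≥0∞` and are stated without subtraction where possible, which removes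
integrability questions. -/

/-- The expectation of `f` under the discrete law `p`. -/
def expect {S : Type*} (p : PMF S) (f : S → ℝ≥0∞) : ℝ≥0∞ := ∑' l, p l * f l

section expect

variable {S T : Type*} (p : PMF S)

lemma expect_add (f g : S → ℝ≥0∞) : expect p (fun s => f s + g s) = expect p f + expect p g := by
  simp only [expect, mul_add, ENNReal.tsum_add]

lemma expect_const (c : ℝ≥0∞) : expect p (fun _ => c) = c := by
  rw [expect, ENNReal.tsum_mul_right, p.tsum_coe, one_mul]

lemma expect_const_mul (c : ℝ≥0∞) (f : S → ℝ≥0∞) :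
    expect p (fun s => c * f s) = c * expect p f := by
  rw [expect, expect, ← ENNReal.tsum_mul_left]
  exact tsum_congr fun s => by ring

lemma expect_mono {f g : S → ℝ≥0∞} (h : ∀ s, f s ≤ g s) : expect p f ≤ expect p g :=
  ENNReal.tsum_le_tsum fun s => mul_le_mul_right (h s) _

lemma expect_le_of_le {f : S → ℝ≥0∞} {c : ℝ≥0∞} (h : ∀ s, f s ≤ c) : expect p f ≤ c :=
  (expect_mono p h).trans (expect_const p c).le

lemma le_expect_of_le {f : S → ℝ≥0∞} {c : ℝ≥0∞} (h : ∀ s, c ≤ f s) : c ≤ expect p f :=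
  (expect_const p c).ge.trans (expect_mono p h)

lemma expect_pure (a : S) (f : S → ℝ≥0∞) : expect (PMF.pure a) f = f a := by
  rw [expect, tsum_eq_single a]
  · simp
  · intro b hb
    simp [PMF.pure_apply, hb]

lemma expect_bind (g : S → PMF T) (f : T → ℝ≥0∞) :
    expect (p.bind g) f = expect p fun s => expect (g s) f := by
  simp only [expect, PMF.bind_apply, ← ENNReal.tsum_mul_right, ← ENNReal.tsum_mul_left]
  rw [ENNReal.tsum_comm]
  exact tsum_congr fun _ => tsum_congr fun _ => mul_assoc _ _ _

lemma expect_sum {ι : Type*} (s : Finset ι) (f : ι → S → ℝ≥0∞) :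
    expect p (fun x => ∑ i ∈ s, f i x) = ∑ i ∈ s, expect p (f i) := by
  classical
  induction s using Finset.induction_on with
  | empty => simpa using expect_const p 0
  | insert a s ha ih => simp only [Finset.sum_insert ha, expect_add, ih]

end expect

/-! ### Killed expectations and first passage probabilities -/

open Classical in
/-- The expectation of `f` after one step of the chain, on the event that the step does not lead
to `j`. -/
def killed {S : Type*} (P : S → PMF S) (j : S) (f : S → ℝ≥0∞) (i : S) : ℝ≥0∞ :=
  ∑' l, if l = j then 0 else P i l * f l

section killed

variable {S : Type*} (P : S → PMF S) (j : S)

lemma firstPassage_succ (n : ℕ) (i : S) :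
    firstPassage P j (n + 1) i = killed P j (firstPassage P j n) i := rfl

lemma add_killed (f : S → ℝ≥0∞) (i : S) : P i j * f j + killed P j f i = expect (P i) f :=
  (ENNReal.tsum_eq_add_tsum_ite (f := fun l => P i l * f l) j).symm

lemma killed_le_killed {f g : S → ℝ≥0∞} {i : S} (h : ∀ l, P i l ≠ 0 → f l ≤ g l) :
    killed P j f i ≤ killed P j g i := by
  refine ENNReal.tsum_le_tsum fun l => ?_
  split_ifs
  · exact le_rfl
  · by_cases hl : P i l = 0
    · simp [hl]
    · exact mul_le_mul_right (h l hl) _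

lemma killed_add (f g : S → ℝ≥0∞) (i : S) :
    killed P j (fun l => f l + g l) i = killed P j f i + killed P j g i := by
  rw [killed, killed, killed, ← ENNReal.tsum_add]
  refine tsum_congr fun l => ?_
  split_ifs
  · simp
  · exact mul_add _ _ _

lemma killed_const_mul (c : ℝ≥0∞) (f : S → ℝ≥0∞) (i : S) :
    killed P j (fun l => c * f l) i = c * killed P j f i := by
  rw [killed, killed, ← ENNReal.tsum_mul_left]
  refine tsum_congr fun l => ?_
  split_ifs
  · simp
  · ring

lemma killed_tsum (f : ℕ → S → ℝ≥0∞) (i : S) :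
    killed P j (fun l => ∑' n, f n l) i = ∑' n, killed P j (f n) i := by
  simp only [killed]
  rw [ENNReal.tsum_comm]
  refine tsum_congr fun l => ?_
  split_ifs
  · simp
  · exact ENNReal.tsum_mul_left.symm

lemma killed_sum (s : Finset ℕ) (f : ℕ → S → ℝ≥0∞) (i : S) :
    killed P j (fun l => ∑ n ∈ s, f n l) i = ∑ n ∈ s, killed P j (f n) i := by
  induction s using Finset.induction_on with
  | empty => simp [killed]
  | insert a s ha ih => simp only [Finset.sum_insert ha, killed_add, ih]

lemma add_killed_one (i : S) : P i j + killed P j (fun _ => 1) i = 1 := by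
  simpa [expect_const] using add_killed P j (fun _ => 1) i

/-- The probability of not visiting `j` at any of the times `1, …, n`. -/
def survival : ℕ → S → ℝ≥0∞
  | 0, _ => 1
  | n + 1, i => killed P j (survival n) i

lemma survival_add_sum_firstPassage (n : ℕ) (i : S) :
    survival P j n i + ∑ m ∈ Finset.range n, firstPassage P j m i = 1 := by
  induction n generalizing i with
  | zero => simp [survival]
  | succ n ih =>
    rw [Finset.sum_range_succ', ← add_assoc, survival]
    simp only [firstPassage_succ]
    rw [← killed_sum, ← killed_add]
    simp only [ih]
    rw [add_comm]
    exact add_killed_one P j i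

lemma sum_firstPassage_le_one (n : ℕ) (i : S) :
    ∑ m ∈ Finset.range n, firstPassage P j m i ≤ 1 :=
  le_add_self.trans (survival_add_sum_firstPassage P j n i).le

/-! ### A Foster criterion -/

variable {P j}

/-- First-step analysis: the partial sums of the survival probabilities satisfy with equality the
recursion for which `V` is a supersolution. The survival series is thus finite when `V` is. -/
lemma sum_survival_le {V : S → ℝ≥0∞} (hV : ∀ i, 1 + killed P j V i ≤ V i) (n : ℕ) (i : S) :
    ∑ m ∈ Finset.range n, survival P j m i ≤ V i := by
  induction n generalizing i with
  | zero => simp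
  | succ n ih =>
    rw [Finset.sum_range_succ', add_comm]
    simp only [survival]
    rw [← killed_sum]
    refine le_trans ?_ (hV i)
    gcongr
    exact killed_le_killed P j fun l _ => ih l

lemma sum_mul_firstPassage_le {V : S → ℝ≥0∞} (hV : ∀ i, 1 + killed P j V i ≤ V i) (n : ℕ)
    (i : S) : ∑ m ∈ Finset.range n, ((m : ℝ≥0∞) + 1) * firstPassage P j m i ≤ V i := by
  induction n generalizing i with
  | zero => simp
  | succ n ih =>
    -- Split the weight `m + 1` as `1 + m`: the first step counts once, and the remaining `m` steps
    -- belong to the chain restarted after a step that missed `j`.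
    have h : ∑ m ∈ Finset.range (n + 1), ((m : ℝ≥0∞) + 1) * firstPassage P j m i
        = ∑ m ∈ Finset.range (n + 1), firstPassage P j m i
          + killed P j (fun l => ∑ m ∈ Finset.range n, ((m : ℝ≥0∞) + 1) * firstPassage P j m l) i := by
      rw [killed_sum]
      simp only [killed_const_mul, ← firstPassage_succ]
      simp only [add_mul, one_mul, Finset.sum_add_distrib]
      rw [Finset.sum_range_succ' (fun m => (m : ℝ≥0∞) * firstPassage P j m i)]
      simp only [Nat.cast_zero, zero_mul, add_zero, Nat.cast_add, Nat.cast_one, add_mul, one_mul,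
        Finset.sum_add_distrib]
      rw [add_comm]
    rw [h]
    refine le_trans ?_ (hV i)
    gcongr
    · exact sum_firstPassage_le_one P j _ i
    · exact killed_le_killed P j fun l _ => ih l

/-- Summable survival probabilities tend to `0`, so the return is almost sure; `V j` bounds the mean
return time. -/
theorem PositiveRecurrent.of_foster {V : S → ℝ≥0∞} (hfin : ∀ i, V i ≠ ∞)
    (hV : ∀ i, 1 + killed P j V i ≤ V i) : PositiveRecurrent P := by
  refine ⟨j, fun i => ?_, ?_⟩
  · have hs : ∑' n, survival P j n i ≠ ∞ :=
      ne_top_of_le_ne_top (hfin i) (ENNReal.tsum_le_of_sum_range_le fun n => sum_survival_le hV n i)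
    have h0 : Filter.Tendsto (fun n => survival P j n i) Filter.atTop (𝓝 0) :=
      ENNReal.tendsto_atTop_zero_of_tsum_ne_top hs
    have h1 := h0.add (ENNReal.tendsto_nat_tsum fun n => firstPassage P j n i)
    simp only [survival_add_sum_firstPassage, zero_add] at h1
    exact (tendsto_nhds_unique h1 tendsto_const_nhds)
  · exact (ENNReal.tsum_le_of_sum_range_le fun n => sum_mul_firstPassage_le hV n j).trans_lt
      (hfin j).lt_top

/-! ### Chains with a uniformly positive drift -/

lemma tail_firstPassage_succ (n : ℕ) (i : S) :
    ∑' m, firstPassage P j (m + (n + 1)) i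
      = killed P j (fun l => ∑' m, firstPassage P j (m + n) l) i := by
  rw [killed_tsum]
  rfl

/-- Optional stopping at `τ ∧ (n + 1)`, with `τ` the first passage time to `j`. The positive drift
makes the stopped mean of `f` at least `f i + (c - b)`; unit increments make it at most `f j` on `τ
≤ n + 1` and `f i + n + 1` on the complement, whose probability is the tail sum. Negative terms have
been moved across. -/
lemma drift_le_tail (hj : ∀ i, ∑' n, firstPassage P j n i = 1) {f : S → ℕ} {b c : ℝ≥0∞}
    (hb : b ≠ ∞) (hbc : b ≤ c)
    (hf : ∀ i l, P i l ≠ 0 → f l ≤ f i + 1)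
    (hdrift : ∀ i, f i + c ≤ expect (P i) (fun l => f l) + b) (n : ℕ) (i : S) :
    f i + f j * ∑' m, firstPassage P j (m + (n + 1)) i + (c - b)
      ≤ f j + (f i + (n + 1 : ℕ)) * ∑' m, firstPassage P j (m + (n + 1)) i := by
  have hd : ∀ i, f i + (c - b) ≤ expect (P i) (fun l => f l) := fun i => by
    refine (ENNReal.add_le_add_iff_right hb).1 ?_
    rw [add_assoc, tsub_add_cancel_of_le hbc]
    exact hdrift i
  -- The induction hypothesis omits `c - b`: only the gain of the first step is kept, and the later
  -- drifts are used merely as nonnegative.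
  have key : ∀ n i, (∀ l, (f l : ℝ≥0∞) + f j * ∑' m, firstPassage P j (m + n) l
      ≤ f j + (f l + n) * ∑' m, firstPassage P j (m + n) l) →
      f i + f j * ∑' m, firstPassage P j (m + (n + 1)) i + (c - b)
      ≤ f j + (f i + (n + 1 : ℕ)) * ∑' m, firstPassage P j (m + (n + 1)) i := by
    intro n i ih
    simp only [tail_firstPassage_succ]
    set T := fun l => ∑' m, firstPassage P j (m + n) l with hT
    have h1 : killed P j (fun l => (f l : ℝ≥0∞) + f j * T l) i
        ≤ killed P j (fun l => (f j : ℝ≥0∞) * 1 + (f i + (n + 1 : ℕ)) * T l) i := by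
      refine killed_le_killed P j fun l hl => (ih l).trans ?_
      rw [mul_one]
      have hl' : (f l : ℝ≥0∞) + n ≤ f i + (n + 1 : ℕ) := by
        have := hf i l hl
        exact_mod_cast (by omega : f l + n ≤ f i + (n + 1))
      exact add_le_add le_rfl (mul_le_mul' hl' le_rfl)
    rw [killed_add, killed_add, killed_const_mul, killed_const_mul, killed_const_mul] at h1
    calc (f i : ℝ≥0∞) + f j * killed P j T i + (c - b)
        = (f i + (c - b)) + f j * killed P j T i := by ring
      _ ≤ expect (P i) (fun l => f l) + f j * killed P j T i := by gcongr; exact hd i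
      _ = P i j * f j + (killed P j (fun l => f l) i + f j * killed P j T i) := by
          rw [← add_killed P j, add_assoc]
      _ ≤ P i j * f j + (f j * killed P j (fun _ => 1) i
            + (f i + (n + 1 : ℕ)) * killed P j T i) := by gcongr
      _ = f j * (P i j + killed P j (fun _ => 1) i)
            + (f i + (n + 1 : ℕ)) * killed P j T i := by ring
      _ = _ := by rw [add_killed_one, mul_one]
  refine key n i ?_
  induction n with
  | zero => intro l; simp [hj, add_comm]
  | succ n ih => exact fun l => le_self_add.trans (key n l ih)

/-- Starting from `j` itself, `drift_le_tail` gives `c - b ≤ (n + 1) P(τ > n + 1)`, while a finite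
mean of `τ` forces the right side to `0`. -/
theorem not_positiveRecurrent_of_drift {P : S → PMF S} {f : S → ℕ} {b c : ℝ≥0∞} (hbc : b < c)
    (hf : ∀ i l, P i l ≠ 0 → f l ≤ f i + 1)
    (hdrift : ∀ i, f i + c ≤ expect (P i) (fun l => f l) + b) : ¬ PositiveRecurrent P := by
  rintro ⟨j, hj, hmean⟩
  have hlim := ENNReal.tendsto_sum_nat_add
    (fun n : ℕ => ((n : ℝ≥0∞) + 1) * firstPassage P j n j) hmean.ne
  have hle : ∀ n : ℕ, c - b ≤ ∑' m, (((m + (n + 1) : ℕ) : ℝ≥0∞) + 1)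
      * firstPassage P j (m + (n + 1)) j := by
    intro n
    have h := drift_le_tail hj hbc.ne_top hbc.le hf hdrift n j
    have hfin : (f j : ℝ≥0∞) + f j * ∑' m, firstPassage P j (m + (n + 1)) j ≠ ∞ := by
      refine ENNReal.add_ne_top.2 ⟨ENNReal.natCast_ne_top _,
        ENNReal.mul_ne_top (ENNReal.natCast_ne_top _) (ne_top_of_le_ne_top ENNReal.one_ne_top ?_)⟩
      rw [← hj j]
      exact ENNReal.tsum_comp_le_tsum_of_injective (add_left_injective (n + 1)) _
    rw [add_mul, ← add_assoc] at h
    refine ((ENNReal.add_le_add_iff_left hfin).1 h).trans ?_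
    rw [← ENNReal.tsum_mul_left]
    refine ENNReal.tsum_le_tsum fun m => ?_
    gcongr
    exact_mod_cast (by omega : n + 1 ≤ m + (n + 1) + 1)
  have := ge_of_tendsto' (hlim.comp (Filter.tendsto_add_atTop_nat 1)) hle
  exact (tsub_pos_of_lt hbc).ne' (le_antisymm this bot_le)

end killed

/-! ### The ingredients of a time slot -/

lemma expect_outputLaw_mix {X Y : Type*} [Fintype X] [Fintype Y] {ε : ℝ}
    (hε : ε ∈ Set.Ioo (0 : ℝ) 1) {C C0 C1 : Channel X Y}
    (hC : C.matrix = ε • C0.matrix + (1 - ε) • C1.matrix) (x : X) (g : Y → ℝ≥0∞) :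
    expect (C.outputLaw x) g = ENNReal.ofReal ε * expect (C0.outputLaw x) g
      + ENNReal.ofReal (1 - ε) * expect (C1.outputLaw x) g := by
  have h1 : ∀ y, C.outputLaw x y = ENNReal.ofReal ε * C0.outputLaw x y
      + ENNReal.ofReal (1 - ε) * C1.outputLaw x y := by
    intro y
    have hε' : 0 ≤ 1 - ε := sub_nonneg.2 hε.2.le
    simp only [Channel.outputLaw, PMF.ofFintype_apply, hC]
    rw [← ENNReal.ofReal_mul hε.1.le, ← ENNReal.ofReal_mul hε',
      ← ENNReal.ofReal_add (mul_nonneg hε.1.le (C0.nonneg x y)) (mul_nonneg hε' (C1.nonneg x y))]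
    simp
  simp only [expect, h1, add_mul, ENNReal.tsum_add, ← ENNReal.tsum_mul_left, mul_assoc]

lemma uniformLaw_const {Z : Type*} [Fintype Z] (z : Z)
    (h : ∀ z', MeasurableSet {u : unitInterval | (fun _ => z) u = z'}) :
    uniformLaw (fun _ => z) h = PMF.pure z := by
  ext z'
  rw [uniformLaw, PMF.ofFintype_apply, PMF.pure_apply]
  by_cases hz : z' = z
  · simp [hz]
  · simp [hz, Ne.symm hz]

lemma uniformLaw_comp {Z Z' : Type*} [Fintype Z] [Fintype Z'] {e : Z → Z'}
    (he : Function.Injective e) (f : unitInterval → Z) (hf : ∀ z, MeasurableSet {u | f u = z})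
    (hf' : ∀ z, MeasurableSet {u | e (f u) = z}) :
    uniformLaw (fun u => e (f u)) hf' = (uniformLaw f hf).map e := by
  classical
  ext z'
  rw [PMF.map_apply, uniformLaw, PMF.ofFintype_apply]
  by_cases hz : ∃ z, z' = e z
  · obtain ⟨z, rfl⟩ := hz
    simp [he.eq_iff, uniformLaw, PMF.ofFintype_apply]
  · push Not at hz
    simp [hz, fun u => (hz (f u)).symm]

lemma expect_arrivalLaw {N : ℕ} (lam : Fin N → ℝ) (h : ∀ i, 0 ≤ lam i ∧ lam i ≤ 1) (j : Fin N) :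
    expect (arrivalLaw lam h) (fun a => ((a j).toNat : ℝ≥0∞)) = ENNReal.ofReal (lam j) := by
  classical
  -- Absorb the value of coordinate `j` into the `j`-th factor, so that the sum over `a` becomes a
  -- product of one-coordinate sums.
  have h1 : ∀ a : Fin N → Bool, arrivalLaw lam h a * ((a j).toNat : ℝ≥0∞)
      = ∏ i, (ENNReal.ofReal (if a i then lam i else 1 - lam i)
        * if i = j then ((a i).toNat : ℝ≥0∞) else 1) := by
    intro a
    rw [Finset.prod_mul_distrib]
    simp [arrivalLaw, PMF.ofFintype_apply]
  simp only [expect, h1, tsum_fintype]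
  rw [← Fintype.prod_sum (fun i b => ENNReal.ofReal (if b then lam i else 1 - lam i)
        * if i = j then ((b : Bool).toNat : ℝ≥0∞) else 1), Finset.prod_eq_single j]
  · simp
  · intro i _ hi
    simp only [hi, if_false, mul_one, Fintype.sum_bool, if_true, Bool.false_eq_true]
    rw [← ENNReal.ofReal_add (h i).1 (sub_nonneg.2 (h i).2)]
    simp
  · simp

section bounds

variable {N : ℕ} {X Y : Type*} [Fintype X] [Fintype Y] {k : ℕ} {Sch : Finset (Fin N → ℕ)}

lemma expect_step (C : Channel X Y) (φ : EncodingPolicy N X k) (ψ : AllocationPolicy Y Sch)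
    (lam : Fin N → ℝ) (h : ∀ i, 0 ≤ lam i ∧ lam i ≤ 1) (w : State N X k)
    (f : State N X k → ℝ≥0∞) :
    expect (step C φ ψ lam h w) f =
      expect (uniformLaw (φ.toFun w.queue w.arrival w.memory) (φ.measurable _ _ _)) fun xm =>
      expect (C.outputLaw xm.1) fun y =>
      expect (uniformLaw (ψ.toFun y) (ψ.measurable y)) fun d =>
      expect (arrivalLaw lam h) fun a => f
        { queue := fun i => (w.queue i - d.1 i) + (a i).toNat
          arrival := a
          memory := xm.2
          signal := xm.1 } := by
  simp only [step, expect_bind, expect_pure]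

lemma queue_le_of_step_ne_zero {C : Channel X Y} {φ : EncodingPolicy N X k}
    {ψ : AllocationPolicy Y Sch} {lam : Fin N → ℝ} {h : ∀ i, 0 ≤ lam i ∧ lam i ≤ 1}
    {w w' : State N X k} (hw : step C φ ψ lam h w w' ≠ 0) (i : Fin N) :
    w'.queue i ≤ w.queue i + 1 := by
  rw [← PMF.mem_support_iff] at hw
  simp only [step, PMF.mem_support_bind_iff, PMF.mem_support_pure_iff] at hw
  obtain ⟨xm, -, y, -, d, -, a, -, rfl⟩ := hw
  have := (a i).toNat_le
  dsimp only
  omega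

/-- A service removes at most `d i` customers because subtraction is truncated. The bound on the
mean service is uniform in the signal, so the encoder's law plays no role. -/
lemma queue_drift_ge {C : Channel X Y} {φ : EncodingPolicy N X k}
    {ψ : AllocationPolicy Y Sch} {lam : Fin N → ℝ} (h : ∀ i, 0 ≤ lam i ∧ lam i ≤ 1) {i : Fin N}
    {b : ℝ≥0∞}
    (hb : ∀ x, expect (C.outputLaw x) (fun y =>
      expect (uniformLaw (ψ.toFun y) (ψ.measurable y)) fun d => (d.1 i : ℝ≥0∞)) ≤ b)
    (w : State N X k) :
    (w.queue i : ℝ≥0∞) + ENNReal.ofReal (lam i)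
      ≤ expect (step C φ ψ lam h w) (fun w' => w'.queue i) + b := by
  rw [expect_step]
  refine le_trans (le_expect_of_le (uniformLaw (φ.toFun w.queue w.arrival w.memory)
    (φ.measurable _ _ _)) fun xm => ?_) ((expect_add _ _ _).trans_le
      (add_le_add le_rfl (expect_const _ b).le))
  refine le_trans ?_ (add_le_add le_rfl (hb xm.1))
  rw [← expect_add]
  refine le_expect_of_le _ fun y => ?_
  rw [← expect_add]
  refine le_expect_of_le _ fun d => ?_
  simp only [Nat.cast_add]
  rw [expect_add, expect_const, expect_arrivalLaw, add_right_comm]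
  gcongr
  exact_mod_cast (by omega : w.queue i ≤ w.queue i - d.1 i + d.1 i)

/-! ### The upper bound -/

lemma sum_le_one_of_mem_parallelSchedules {d : Fin N → ℕ} (hd : d ∈ parallelSchedules N) :
    ∑ i, d i ≤ 1 := by
  simp only [parallelSchedules, Finset.mem_insert, Finset.mem_image, Finset.mem_univ,
    true_and] at hd
  rcases hd with rfl | ⟨i, rfl⟩
  · simp
  · simp

lemma sum_lt_one_of_mem_maxCapacityRegion (hN : 0 < N) {lam : Fin N → ℝ}
    (h : lam ∈ maxCapacityRegion (parallelSchedules N)) : ∑ i, lam i < 1 := by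
  have : NeZero N := ⟨hN.ne'⟩
  obtain ⟨-, y, hy, hlt⟩ := h
  refine (Finset.sum_lt_sum_of_nonempty Finset.univ_nonempty fun i _ => hlt i).trans_le ?_
  have hconv : Convex ℝ {z : Fin N → ℝ | ∑ i, z i ≤ 1} :=
    convex_halfSpace_le (f := fun z : Fin N → ℝ => ∑ i, z i)
      ⟨fun x y => by simp [Finset.sum_add_distrib], fun c x => by simp [Finset.mul_sum]⟩ 1
  refine convexHull_min ?_ hconv hy
  rintro _ ⟨d, hd, rfl⟩
  have := sum_le_one_of_mem_parallelSchedules (Finset.mem_coe.1 hd)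
  simp only [Set.mem_ofPred_eq]
  exact_mod_cast this

lemma single_mem_maxCapacityRegion (hN : 0 < N) (i : Fin N) {t : ℝ} (ht0 : 0 ≤ t) (ht1 : t < 1) :
    Pi.single i t ∈ maxCapacityRegion (parallelSchedules N) := by
  have hN' : (0 : ℝ) < N := Nat.cast_pos.2 hN
  have hs : 0 < (1 - t) / N := div_pos (sub_pos.2 ht1) hN'
  have hnn : ∀ j, 0 ≤ (Pi.single i t : Fin N → ℝ) j := fun j =>
    (Pi.single_nonneg.2 ht0 : (0 : Fin N → ℝ) ≤ Pi.single i t) j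
  -- Spreading the slack `1 - t` evenly gives strict domination in every coordinate while `y` stays
  -- a convex combination of the unit vectors.
  set y : Fin N → ℝ := fun j => (Pi.single i t : Fin N → ℝ) j + (1 - t) / N with hy
  refine ⟨hnn, y, ?_, fun j => lt_add_of_pos_right _ hs⟩
  have hy1 : ∑ j, y j = 1 := by
    simp only [hy, Finset.sum_add_distrib, Finset.sum_pi_single', Finset.sum_const,
      Finset.card_univ, Fintype.card_fin, nsmul_eq_mul, Finset.mem_univ, if_true]
    field_simp
    ring
  have hmem := (convex_convexHull ℝ ((fun (d : Fin N → ℕ) (i : Fin N) => (d i : ℝ)) ''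
    (parallelSchedules N : Set (Fin N → ℕ)))).sum_mem (t := Finset.univ) (w := y)
    (z := fun j => Pi.single j (1 : ℝ)) (fun j _ => add_nonneg (hnn j) hs.le) hy1
    (fun j _ => subset_convexHull ℝ _ ⟨Pi.single j 1, by simp [parallelSchedules], by
      ext l; by_cases hl : l = j
      · subst hl; simp
      · simp [hl]⟩)
  convert hmem using 1
  ext l
  simp [Finset.sum_apply, Pi.single_apply]

theorem le_of_smul_subset_capacityRegion (hN : 0 < N) {ε : ℝ} (hε : ε ∈ Set.Ioo (0 : ℝ) 1)
    {C : Channel X Y} (hC : C.IsMajorizing ε) (φ : EncodingPolicy N X k)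
    (ψ : AllocationPolicy Y (parallelSchedules N)) {ρ : ℝ}
    (hρ : ∀ lam ∈ maxCapacityRegion (parallelSchedules N), ρ • lam ∈ capacityRegion C φ ψ) :
    ρ ≤ 1 - ε * (1 - 1 / (N : ℝ)) := by
  have : NeZero N := ⟨hN.ne'⟩
  have hN' : (0 : ℝ) < N := Nat.cast_pos.2 hN
  obtain ⟨C0, C1, hrow, -, hmix⟩ := hC
  set g : Fin N → Y → ℝ≥0∞ := fun i y =>
    expect (uniformLaw (ψ.toFun y) (ψ.measurable y)) fun d => (d.1 i : ℝ≥0∞) with hg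
  have hsum : ∀ y, ∑ i, g i y ≤ 1 := fun y => by
    rw [← expect_sum]
    refine expect_le_of_le _ fun d => ?_
    exact_mod_cast sum_le_one_of_mem_parallelSchedules d.2
  -- Any signal serves as reference, since the rows of `C0` agree; the encoder shows that one
  -- exists.
  let x₀ : X := (φ.toFun 0 (fun _ => false) (fun _ => false) 0).1
  obtain ⟨i, -, hi⟩ : ∃ i ∈ (Finset.univ : Finset (Fin N)),
      expect (C0.outputLaw x₀) (g i) ≤ (N : ℝ≥0∞)⁻¹ := by
    -- Pigeonhole: if all `N` mean services exceeded `1 / N`, they would sum to more than `1`.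
    by_contra! hlt
    have h1 := ENNReal.sum_lt_sum_of_nonempty Finset.univ_nonempty hlt
    rw [← expect_sum] at h1
    refine (h1.trans_le (expect_le_of_le _ hsum)).ne ?_
    simp only [Finset.sum_const, Finset.card_univ, Fintype.card_fin, nsmul_eq_mul]
    exact ENNReal.mul_inv_cancel (by simpa using hN.ne') (ENNReal.natCast_ne_top N)
  set b : ℝ := 1 - ε * (1 - 1 / (N : ℝ)) with hbdef
  have hbpos : 0 < b := by
    have h1 : b = (1 - ε) + ε * (1 / (N : ℝ)) := by rw [hbdef]; ring
    rw [h1]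
    exact add_pos_of_pos_of_nonneg (sub_pos.2 hε.2) (mul_nonneg hε.1.le (by positivity))
  have hb : ∀ x, expect (C.outputLaw x) (g i) ≤ ENNReal.ofReal b := by
    intro x
    have hx : C0.outputLaw x = C0.outputLaw x₀ := by
      ext y
      simp [Channel.outputLaw, hrow x x₀ y]
    rw [expect_outputLaw_mix hε hmix, hx]
    have h1 : ENNReal.ofReal b
        = ENNReal.ofReal ε * (N : ℝ≥0∞)⁻¹ + ENNReal.ofReal (1 - ε) * 1 := by
      rw [mul_one, ← ENNReal.ofReal_natCast, ← ENNReal.ofReal_inv_of_pos hN',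
        ← ENNReal.ofReal_mul hε.1.le, ← ENNReal.ofReal_add
          (mul_nonneg hε.1.le (by positivity)) (sub_nonneg.2 hε.2.le), hbdef]
      congr 1
      ring
    rw [h1]
    gcongr
    exact expect_le_of_le _ fun y =>
      (Finset.single_le_sum (fun _ _ => zero_le) (Finset.mem_univ i)).trans (hsum y)
  by_contra! hlt
  have hρpos : 0 < ρ := hbpos.trans hlt
  obtain ⟨t, ht0, ht1⟩ := exists_between ((div_lt_one hρpos).2 hlt)
  have htpos : 0 < t := (div_pos hbpos hρpos).trans ht0
  obtain ⟨h, hrec⟩ := hρ _ (single_mem_maxCapacityRegion hN i htpos.le ht1)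
  refine not_positiveRecurrent_of_drift (f := fun w : State N X k => w.queue i)
    (b := ENNReal.ofReal b) (c := ENNReal.ofReal (ρ * t)) ?_
    (fun w w' hw => queue_le_of_step_ne_zero hw i) (fun w => ?_) hrec
  · rw [ENNReal.ofReal_lt_ofReal_iff (mul_pos hρpos htpos)]
    rwa [div_lt_iff₀' hρpos] at ht0
  · simpa using queue_drift_ge h hb w

lemma bound_nonneg (hN : 0 < N) {ε : ℝ} (hε : ε ∈ Set.Ioo (0 : ℝ) 1) :
    0 ≤ 1 - ε * (1 - 1 / (N : ℝ)) := by
  have h1 : 1 - ε * (1 - 1 / (N : ℝ)) = (1 - ε) + ε * (1 / (N : ℝ)) := by ring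
  rw [h1]
  exact add_nonneg (sub_nonneg.2 hε.2.le) (mul_nonneg hε.1.le (by positivity))

theorem policyCapacityFactor_le (hN : 0 < N) {ε : ℝ} (hε : ε ∈ Set.Ioo (0 : ℝ) 1)
    {C : Channel X Y} (hC : C.IsMajorizing ε) (φ : EncodingPolicy N X k)
    (ψ : AllocationPolicy Y (parallelSchedules N)) :
    policyCapacityFactor C φ ψ ≤ 1 - ε * (1 - 1 / (N : ℝ)) :=
  Real.sSup_le (fun _ hρ => le_of_smul_subset_capacityRegion hN hε hC φ ψ hρ.2)
    (bound_nonneg hN hε)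

theorem capacityFactor_le (hN : 0 < N) {ε : ℝ} (hε : ε ∈ Set.Ioo (0 : ℝ) 1)
    {C : Channel X Y} (hC : C.IsMajorizing ε) (k : ℕ) :
    capacityFactor (parallelSchedules N) C k ≤ 1 - ε * (1 - 1 / (N : ℝ)) := by
  refine Real.sSup_le ?_ (bound_nonneg hN hε)
  rintro _ ⟨φ, ψ, rfl⟩
  exact policyCapacityFactor_le hN hε hC φ ψ

/-! ### Monotonicity in the encoder memory -/

open Classical in
lemma killed_eq_expect {S : Type*} (P : S → PMF S) (j : S) (f : S → ℝ≥0∞) (i : S) :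
    killed P j f i = expect (P i) (fun l => if l = j then 0 else f l) := by
  refine tsum_congr fun l => ?_
  split_ifs <;> simp [*]

lemma expect_map {S T : Type*} (p : PMF S) (e : S → T) (f : T → ℝ≥0∞) :
    expect (p.map e) f = expect p (fun s => f (e s)) := by
  simp only [PMF.map, expect_bind, Function.comp_apply, expect_pure]

/-- From any state `i`, even outside the range of `e`, the chain `P'` moves as the `e`-image of `P`
started at `r i`. First passage probabilities to `e j` and to `j` therefore coincide. -/
theorem PositiveRecurrent.of_map {S T : Type*} {P : S → PMF S} {P' : T → PMF T} {e : S → T}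
    {r : T → S} (her : Function.LeftInverse r e) (hP : ∀ i, P' i = (P (r i)).map e)
    (h : PositiveRecurrent P) : PositiveRecurrent P' := by
  classical
  obtain ⟨j, hj, hmean⟩ := h
  have hfp : ∀ n i, firstPassage P' (e j) n i = firstPassage P j n (r i) := by
    intro n
    induction n with
    | zero =>
      intro i
      simp only [firstPassage, hP, PMF.map_apply, her.injective.eq_iff]
      simp
    | succ n ih =>
      intro i
      rw [firstPassage_succ, firstPassage_succ, killed_eq_expect, killed_eq_expect, hP, expect_map]
      simp only [her.injective.eq_iff, ih, her _]
  refine ⟨e j, fun i => ?_, ?_⟩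
  · simp only [hfp, hj]
  · simpa only [hfp, her _] using hmean

/-- The encoding policy with an additional memory bit that is never used. -/
def EncodingPolicy.addBit (φ : EncodingPolicy N X k) : EncodingPolicy N X (k + 1) where
  toFun q a m u := Prod.map id (fun m' => Fin.snoc (α := fun _ => Bool) m' false)
    (φ.toFun q a (Fin.init m) u)
  measurable q a m z := by
    have h : {u | Prod.map id (fun m' => Fin.snoc (α := fun _ => Bool) m' false)
        (φ.toFun q a (Fin.init m) u) = z}
        = {u | φ.toFun q a (Fin.init m) u = (z.1, Fin.init z.2)}
          ∩ {_u | z.2 (Fin.last k) = false} := by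
      ext u
      obtain ⟨x, m'⟩ := z
      simp only [Set.mem_ofPred_eq, Set.mem_inter_iff, Prod.ext_iff, Prod.map_fst, Prod.map_snd, id]
      constructor
      · rintro ⟨h1, rfl⟩
        simp [h1]
      · rintro ⟨⟨h1, h2⟩, h3⟩
        refine ⟨h1, ?_⟩
        rw [h2, ← h3, Fin.snoc_init_self]
    rw [h]
    exact (φ.measurable _ _ _ _).inter (MeasurableSet.const _)

lemma step_addBit (C : Channel X Y) (φ : EncodingPolicy N X k) (ψ : AllocationPolicy Y Sch)
    (lam : Fin N → ℝ) (h : ∀ i, 0 ≤ lam i ∧ lam i ≤ 1) (w : State N X (k + 1)) :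
    step C φ.addBit ψ lam h w =
      (step C φ ψ lam h ⟨w.queue, w.arrival, Fin.init w.memory, w.signal⟩).map
        fun s => ⟨s.queue, s.arrival, Fin.snoc (α := fun _ => Bool) s.memory false, s.signal⟩ := by
  have hinj : Function.Injective (Prod.map (id : X → X)
      (fun m' : Fin k → Bool => Fin.snoc (α := fun _ => Bool) m' false)) :=
    Function.injective_id.prodMap fun m m' hm => by
      simpa using congrArg (Fin.init (α := fun _ => Bool)) hm
  have hu := uniformLaw_comp hinj (φ.toFun w.queue w.arrival (Fin.init w.memory))
    (φ.measurable _ _ _) (φ.addBit.measurable w.queue w.arrival w.memory)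
  simp only [step, EncodingPolicy.addBit] at hu ⊢
  rw [hu]
  simp only [PMF.bind_map, PMF.map_bind, PMF.pure_map, Function.comp_def, Prod.map_fst,
    Prod.map_snd, id]

lemma capacityRegion_subset_addBit (C : Channel X Y) (φ : EncodingPolicy N X k)
    (ψ : AllocationPolicy Y Sch) : capacityRegion C φ ψ ⊆ capacityRegion C φ.addBit ψ := by
  rintro lam ⟨h, hrec⟩
  exact ⟨h, hrec.of_map (fun s => by simp) (step_addBit C φ ψ lam h)⟩

theorem capacityFactor_monotone (hN : 0 < N) {ε : ℝ} (hε : ε ∈ Set.Ioo (0 : ℝ) 1)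
    {C : Channel X Y} (hC : C.IsMajorizing ε) :
    Monotone (capacityFactor (parallelSchedules N) C) := by
  refine monotone_nat_of_le_succ fun k => Real.sSup_le ?_ ?_
  · rintro _ ⟨φ, ψ, rfl⟩
    refine le_csSup_of_le ⟨1 - ε * (1 - 1 / (N : ℝ)), ?_⟩ ⟨φ.addBit, ψ, rfl⟩ ?_
    · rintro _ ⟨φ', ψ', rfl⟩
      exact policyCapacityFactor_le hN hε hC φ' ψ'
    -- The second obligation, nonnegativity of the target, covers the supremum of an empty set,
    -- which is `0`.
    · refine Real.sSup_le (fun ρ hρ => le_csSup ⟨1 - ε * (1 - 1 / (N : ℝ)), fun ρ' hρ' =>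
        le_of_smul_subset_capacityRegion hN hε hC _ _ hρ'.2⟩
        ⟨hρ.1, fun lam hlam => capacityRegion_subset_addBit C φ ψ (hρ.2 lam hlam)⟩) ?_
      exact Real.sSup_nonneg fun ρ hρ => hρ.1
  · refine Real.sSup_nonneg ?_
    rintro _ ⟨φ, ψ, rfl⟩
    exact Real.sSup_nonneg fun ρ hρ => hρ.1

end bounds

section attainment

variable {N : ℕ}

/-! ### Serving the smallest nonempty queue -/

/-- The signal sent by `firstNonemptyEncoder i₀` when the queue lengths are `q`. -/
def firstNonempty (i₀ : Fin N) (q : Fin N → ℕ) : Fin N :=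
  (Finset.univ.filter fun i => 0 < q i).min.untopD i₀

lemma firstNonempty_zero (i₀ : Fin N) : firstNonempty i₀ 0 = i₀ := by
  simp [firstNonempty]

lemma firstNonempty_pos (i₀ : Fin N) {q : Fin N → ℕ} (hq : q ≠ 0) :
    0 < q (firstNonempty i₀ q) := by
  obtain ⟨i, hi⟩ := Function.ne_iff.1 hq
  have hne : (Finset.univ.filter fun i => 0 < q i).Nonempty :=
    ⟨i, by simpa [Nat.pos_iff_ne_zero] using hi⟩
  have := Finset.min'_mem _ hne
  rw [firstNonempty, ← Finset.coe_min' hne, WithTop.untopD_coe]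
  exact (Finset.mem_filter.1 this).2

lemma step_firstNonempty (C : Channel (Fin N) (Fin N)) (i₀ : Fin N) (lam : Fin N → ℝ)
    (h : ∀ i, 0 ≤ lam i ∧ lam i ≤ 1) (w : State N (Fin N) 0) :
    step C (firstNonemptyEncoder i₀) (serveMessage N) lam h w =
      (C.outputLaw (firstNonempty i₀ w.queue)).bind fun y => (arrivalLaw lam h).bind fun a =>
        PMF.pure
          { queue := fun i => (w.queue i - (Pi.single y 1 : Fin N → ℕ) i) + (a i).toNat
            arrival := a
            memory := w.memory
            signal := firstNonempty i₀ w.queue } := by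
  simp only [step, firstNonemptyEncoder, serveMessage, uniformLaw_const, PMF.pure_bind,
    firstNonempty]

lemma sum_serve_add_le (q : Fin N → ℕ) {s : Fin N} (hs : 0 < q s) (y : Fin N) :
    ∑ i, (q i - (Pi.single y 1 : Fin N → ℕ) i) + (if y = s then 1 else 0) ≤ ∑ i, q i := by
  split_ifs with hy
  · subst hy
    have h1 : ∑ i, (Pi.single y 1 : Fin N → ℕ) i = 1 := by simp
    rw [← h1, ← Finset.sum_add_distrib]
    refine Finset.sum_le_sum fun i _ => ?_
    by_cases hi : i = y
    · subst hi
      simp only [Pi.single_eq_same]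
      omega
    · simp [hi]
  · rw [add_zero]
    exact Finset.sum_le_sum fun i _ => Nat.sub_le _ _

/-- The total queue length. -/
def totalQueue (w : State N (Fin N) 0) : ℝ≥0∞ := ((∑ i, w.queue i : ℕ) : ℝ≥0∞)

/-- Only correct receptions are counted: they surely remove a customer, since the signalled queue is
nonempty. Any other service can only help. -/
lemma totalQueue_drift_le (C : Channel (Fin N) (Fin N)) (i₀ : Fin N) {lam : Fin N → ℝ}
    (h : ∀ i, 0 ≤ lam i ∧ lam i ≤ 1) {w : State N (Fin N) 0} (hw : w.queue ≠ 0) :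
    expect (step C (firstNonemptyEncoder i₀) (serveMessage N) lam h w) totalQueue
        + C.outputLaw (firstNonempty i₀ w.queue) (firstNonempty i₀ w.queue)
      ≤ totalQueue w + ENNReal.ofReal (∑ i, lam i) := by
  set s := firstNonempty i₀ w.queue with hs
  have h1 : C.outputLaw s s
      = expect (C.outputLaw s) fun y => ((if y = s then 1 else 0 : ℕ) : ℝ≥0∞) := by
    simp [expect, tsum_fintype]
  rw [h1, step_firstNonempty, expect_bind, ← hs, ← expect_add]
  refine expect_le_of_le _ fun y => ?_
  simp only [expect_bind, expect_pure, totalQueue, Finset.sum_add_distrib, Nat.cast_add]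
  rw [expect_add, expect_const]
  simp only [Nat.cast_sum, expect_sum, expect_arrivalLaw]
  rw [← ENNReal.ofReal_sum_of_nonneg fun i _ => (h i).1, add_right_comm]
  gcongr
  exact_mod_cast sum_serve_add_le w.queue (firstNonempty_pos i₀ hw) y

lemma arrivalLaw_false_ne_zero {lam : Fin N → ℝ} (h : ∀ i, 0 ≤ lam i ∧ lam i ≤ 1)
    (h1 : ∀ i, lam i < 1) : arrivalLaw lam h (fun _ => false) ≠ 0 := by
  simp [arrivalLaw, PMF.ofFintype_apply, Finset.prod_ne_zero_iff, h1]

/-- With all queues empty the signal is `i₀` and no service has any effect, so a slot without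
arrivals ends in this very state. -/
lemma arrivalLaw_le_step (C : Channel (Fin N) (Fin N)) (i₀ : Fin N) {lam : Fin N → ℝ}
    (h : ∀ i, 0 ≤ lam i ∧ lam i ≤ 1) {w : State N (Fin N) 0} (hw : w.queue = 0) :
    arrivalLaw lam h (fun _ => false)
      ≤ step C (firstNonemptyEncoder i₀) (serveMessage N) lam h w
          ⟨0, fun _ => false, fun _ => false, i₀⟩ := by
  rw [step_firstNonempty, PMF.bind_apply, hw, firstNonempty_zero]
  refine le_expect_of_le (C.outputLaw i₀) fun y => ?_
  rw [PMF.bind_apply]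
  refine le_trans ?_ (ENNReal.le_tsum fun _ => false)
  rw [Subsingleton.elim w.memory fun _ => false, PMF.pure_apply, if_pos, mul_one]
  congr 1
  ext i
  simp

lemma totalQueue_le_of_step_ne_zero {C : Channel (Fin N) (Fin N)} {i₀ : Fin N}
    {lam : Fin N → ℝ} {h : ∀ i, 0 ≤ lam i ∧ lam i ≤ 1} {w w' : State N (Fin N) 0}
    (hw : w.queue = 0)
    (hstep : step C (firstNonemptyEncoder i₀) (serveMessage N) lam h w w' ≠ 0) :
    totalQueue w' ≤ N := by
  rw [totalQueue]
  have h1 : ∑ i, w'.queue i ≤ ∑ _i : Fin N, 1 := Finset.sum_le_sum fun i _ => by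
    simpa [hw] using queue_le_of_step_ne_zero hstep i
  simp only [Finset.sum_const, Finset.card_univ, Fintype.card_fin, smul_eq_mul, mul_one] at h1
  exact_mod_cast h1

theorem positiveRecurrent_firstNonempty (C : Channel (Fin N) (Fin N)) (i₀ : Fin N)
    {lam : Fin N → ℝ} (h : ∀ i, 0 ≤ lam i ∧ lam i ≤ 1) (hlt : ∀ i, lam i < 1) {b : ℝ}
    (hC : ∀ i, C.matrix i i = b) (hb : ∑ i, lam i < b) :
    PositiveRecurrent (step C (firstNonemptyEncoder i₀) (serveMessage N) lam h) := by
  set P := step C (firstNonemptyEncoder i₀) (serveMessage N) lam h with hP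
  set j : State N (Fin N) 0 := ⟨0, fun _ => false, fun _ => false, i₀⟩ with hj
  set p := arrivalLaw lam h (fun _ => false) with hp
  have hp0 : p ≠ 0 := arrivalLaw_false_ne_zero h hlt
  have hptop : p ≠ ∞ := PMF.apply_ne_top _ _
  set η := ENNReal.ofReal (b - ∑ i, lam i) with hη
  have hη0 : η ≠ 0 := by simpa [hη] using hb
  have hηtop : η ≠ ∞ := ENNReal.ofReal_ne_top
  have ha : η⁻¹ ≠ ∞ := ENNReal.inv_ne_top.2 hη0
  have haN : η⁻¹ * N + 1 ≠ ∞ :=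
    ENNReal.add_ne_top.2 ⟨ENNReal.mul_ne_top ha (ENNReal.natCast_ne_top N), ENNReal.one_ne_top⟩
  -- The factor `η⁻¹` normalizes the drift to `-1` at nonempty states. `K` is chosen so that `p * K
  -- = η⁻¹ * N + 1`: killing at `j`, of probability at least `p` from an empty configuration, then
  -- pays for up to `N` new arrivals and the unit cost.
  set K := p⁻¹ * (η⁻¹ * N + 1) with hK
  have hKtop : K ≠ ∞ := ENNReal.mul_ne_top (ENNReal.inv_ne_top.2 hp0) haN
  refine PositiveRecurrent.of_foster (j := j) (V := fun w => η⁻¹ * totalQueue w + K)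
    (fun w => ENNReal.add_ne_top.2 ⟨ENNReal.mul_ne_top ha (ENNReal.natCast_ne_top _), hKtop⟩)
    fun w => ?_
  by_cases hw : w.queue = 0
  · have h1 : killed P j (fun w => η⁻¹ * totalQueue w + K) w
        ≤ killed P j (fun _ => η⁻¹ * N + K) w := by
      refine killed_le_killed P j fun l hl => ?_
      gcongr
      exact totalQueue_le_of_step_ne_zero hw hl
    have h2 : P w j * (η⁻¹ * N + K) + killed P j (fun _ => η⁻¹ * N + K) w = η⁻¹ * N + K := by
      rw [add_killed P j (fun _ => η⁻¹ * N + K), expect_const]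
    have h3 : η⁻¹ * N + 1 ≤ P w j * (η⁻¹ * N + K) := by
      calc η⁻¹ * N + 1 = p * K := by
            rw [hK, ← mul_assoc, ENNReal.mul_inv_cancel hp0 hptop, one_mul]
        _ ≤ P w j * (η⁻¹ * N + K) := by
            gcongr
            · exact arrivalLaw_le_step C i₀ h hw
            · exact le_add_self
    have h4 : totalQueue w = 0 := by simp [totalQueue, hw]
    simp only [h4, mul_zero, zero_add]
    -- Adding the finite `η⁻¹ * N + 1` to both sides lets the mass sent to `j` enter through `h3`,
    -- and `h2` then collapses the sum.
    refine (ENNReal.add_le_add_iff_left haN).1 ?_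
    calc η⁻¹ * N + 1 + (1 + killed P j (fun w => η⁻¹ * totalQueue w + K) w)
        ≤ P w j * (η⁻¹ * N + K) + (1 + killed P j (fun _ => η⁻¹ * N + K) w) := by gcongr
      _ = (P w j * (η⁻¹ * N + K) + killed P j (fun _ => η⁻¹ * N + K) w) + 1 := by ring
      _ = η⁻¹ * N + 1 + K := by rw [h2]; ring
  · have h1 := totalQueue_drift_le C i₀ h hw
    have hs0 : 0 ≤ ∑ i, lam i := Finset.sum_nonneg fun i _ => (h i).1
    have h2 : C.outputLaw (firstNonempty i₀ w.queue) (firstNonempty i₀ w.queue)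
        = η + ENNReal.ofReal (∑ i, lam i) := by
      rw [hη, ← ENNReal.ofReal_add (sub_nonneg.2 hb.le) hs0, sub_add_cancel]
      simp [Channel.outputLaw, hC]
    rw [h2, ← add_assoc, ENNReal.add_le_add_iff_right ENNReal.ofReal_ne_top] at h1
    calc 1 + killed P j (fun w => η⁻¹ * totalQueue w + K) w
        ≤ 1 + expect (P w) (fun w => η⁻¹ * totalQueue w + K) := by
          gcongr
          rw [← add_killed P j]
          exact le_add_self
      _ = η⁻¹ * (expect (P w) totalQueue + η) + K := by
          rw [expect_add, expect_const, expect_const_mul, mul_add, ENNReal.inv_mul_cancel hη0 hηtop]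
          ring
      _ ≤ η⁻¹ * totalQueue w + K := by gcongr

lemma isMajorizing_mix_uniform_identity (hN : 2 ≤ N) {ε : ℝ} (hε : ε ∈ Set.Ioo (0 : ℝ) 1) :
    (Channel.mix ε hε (Channel.uniform N) (Channel.identity N)).IsMajorizing ε := by
  have : Nontrivial (Fin N) := Fin.nontrivial_iff_two_le.2 hN
  refine ⟨Channel.uniform N, Channel.identity N, fun _ _ _ => rfl, fun y => ?_, rfl⟩
  obtain ⟨x, hx⟩ := exists_ne y
  exact ⟨x, Matrix.one_apply_ne hx⟩

theorem policyCapacityFactor_firstNonempty (hN : 2 ≤ N) {ε : ℝ} (hε : ε ∈ Set.Ioo (0 : ℝ) 1)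
    (i₀ : Fin N) :
    policyCapacityFactor (Channel.mix ε hε (Channel.uniform N) (Channel.identity N))
      (firstNonemptyEncoder i₀) (serveMessage N) = 1 - ε * (1 - 1 / (N : ℝ)) := by
  have hN0 : 0 < N := by omega
  have hmaj := isMajorizing_mix_uniform_identity hN hε
  set b : ℝ := 1 - ε * (1 - 1 / (N : ℝ)) with hb
  have hinv : 1 / (N : ℝ) < 1 := by
    rw [div_lt_one (by positivity)]
    exact_mod_cast hN
  have hb1 : b ≤ 1 := sub_le_self _ (mul_nonneg hε.1.le (sub_nonneg.2 hinv.le))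
  have hb0 : 0 < b := by
    have := mul_lt_mul hε.2 (sub_le_self 1 (by positivity : 0 ≤ 1 / (N : ℝ))) (sub_pos.2 hinv)
      zero_le_one
    linarith
  refine IsGreatest.csSup_eq ⟨⟨hb0.le, fun lam hlam => ?_⟩, fun ρ hρ =>
    le_of_smul_subset_capacityRegion hN0 hε hmaj _ _ hρ.2⟩
  have hsum := sum_lt_one_of_mem_maxCapacityRegion hN0 hlam
  -- Strictness gives the slot without arrivals positive probability.
  have hlam1 : ∀ i, b * lam i < 1 := fun i =>
    (mul_le_of_le_one_left (hlam.1 i) hb1).trans_lt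
      ((Finset.single_le_sum (fun i _ => hlam.1 i) (Finset.mem_univ i)).trans_lt hsum)
  refine ⟨fun i => ⟨mul_nonneg hb0.le (hlam.1 i), (hlam1 i).le⟩,
    positiveRecurrent_firstNonempty (b := b) _ i₀ _ hlam1 (fun i => ?_) ?_⟩
  · change ε * (1 / (N : ℝ)) + (1 - ε) * (1 : Matrix (Fin N) (Fin N) ℝ) i i = b
    rw [Matrix.one_apply_eq, hb]
    ring
  · simp only [Pi.smul_apply, smul_eq_mul, ← Finset.mul_sum]
    exact mul_lt_of_lt_one_right hb0 hsum

end attainment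

end SPII

end

theorem mainTheorem3 (N : ℕ) (hN : 2 ≤ N) (ε : ℝ) (hε : ε ∈ Set.Ioo (0 : ℝ) 1) :
    (∀ (X Y : Type*) [Fintype X] [Fintype Y] (C : SPII.Channel X Y), C.IsMajorizing ε →
      (∀ k : ℕ, SPII.capacityFactor (SPII.parallelSchedules N) C k ≤ 1 - ε * (1 - 1 / (N : ℝ))) ∧
      ∃ ρinf : ℝ,
        Filter.Tendsto (fun k : ℕ => SPII.capacityFactor (SPII.parallelSchedules N) C k)
          Filter.atTop (𝓝 ρinf) ∧
        ρinf ≤ 1 - ε * (1 - 1 / (N : ℝ))) ∧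
    (SPII.Channel.mix ε hε (SPII.Channel.uniform N) (SPII.Channel.identity N)).IsMajorizing ε ∧
    SPII.capacityFactor (SPII.parallelSchedules N)
      (SPII.Channel.mix ε hε (SPII.Channel.uniform N) (SPII.Channel.identity N)) 0
        = 1 - ε * (1 - 1 / (N : ℝ)) ∧
    ∀ i₀ : Fin N,
      SPII.policyCapacityFactor
        (SPII.Channel.mix ε hε (SPII.Channel.uniform N) (SPII.Channel.identity N))
        (SPII.firstNonemptyEncoder i₀) (SPII.serveMessage N)
          = 1 - ε * (1 - 1 / (N : ℝ)) := by
  have hN0 : 0 < N := by omega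
  have hmaj := SPII.isMajorizing_mix_uniform_identity hN hε
  refine ⟨fun X Y _ _ C hC => ⟨SPII.capacityFactor_le hN0 hε hC, ?_⟩, hmaj, ?_,
    SPII.policyCapacityFactor_firstNonempty hN hε⟩
  · have hbdd : BddAbove (Set.range (SPII.capacityFactor (SPII.parallelSchedules N) C)) := by
      refine ⟨1 - ε * (1 - 1 / (N : ℝ)), ?_⟩
      rintro _ ⟨k, rfl⟩
      exact SPII.capacityFactor_le hN0 hε hC k
    exact ⟨_, tendsto_atTop_ciSup (SPII.capacityFactor_monotone hN0 hε hC) hbdd,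
      ciSup_le (SPII.capacityFactor_le hN0 hε hC)⟩
  · refine le_antisymm (SPII.capacityFactor_le hN0 hε hmaj 0) (le_csSup
      ⟨1 - ε * (1 - 1 / (N : ℝ)), ?_⟩
      ⟨SPII.firstNonemptyEncoder ⟨0, hN0⟩, SPII.serveMessage N,
        (SPII.policyCapacityFactor_firstNonempty hN hε _).symm⟩)
    rintro _ ⟨φ, ψ, rfl⟩
    exact SPII.policyCapacityFactor_le hN0 hε hmaj φ ψ
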